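/- Let $N\ge 2$ and $\alpha\in\mathbb R$. Definitions. For a unit vector $|\psi\rangle\in(\mathbb C^2)^{\otimes N}$ put $$C_{GM}(|\psi\rangle)=\min_{A}\sqrt2\,\sqrt{1-\operatorname{Tr}(\rho_A^2)},$$ where $A$ runs over the bipartitions $A\,|\,A^c$ of the $N$ qubits into two non-empty parts and $\rho_A$ is the reduced density matrix of $|\psi\rangle\langle\psi|$ on $A$. For a density matrix $\rho$ of $N$ qubits, the genuinely multipartite (GM) concurrence is $$C_{GM}(\rho)=\min\sum_i p_i\,C_{GM}(|\psi_i\rangle),$$ the minimum being over all finite pure-state decompositions $\rho=\sum_i p_i|\psi_i\rangle\langle\psi_i|$, with $p_i\ge0$, $\sum_i p_i=1$ and unit vectors $|\psi_i\rangle$. The amplitude-damping channel with decay probability $P\in[0,1]$ on a qubit with levels $|g\rangle,|e\rangle$ is $\rho\mapsto K_0\rho K_0^\dagger+K_1\rho K_1^\dagger$ with $K_0=|g\rangle\langle g|+\sqrt{1-P}\,|e\rangle\langle e|$ and $K_1=\sqrt P\,|g\rangle\langle e|$. Let $\rho_N(\alpha,P)$ be the state obtained from $\cos\alpha\,|e\rangle^{\otimes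 N}+\sin\alpha\,|g\rangle^{\otimes N}$ when each of the $N$ qubits passes through its own amplitude-damping channel with decay probability $P$. (1) For every $P\in[0,1]$, the minimum defining $C_{GM}(\rho_N(\alpha,P))$ is attained, and $$C_{GM}(\rho_N(\alpha,P))=\max\Big\{0,\;2\cos^2\alpha\,(1-P)^{N/2}\big(|\tan\alpha|-(2^{N-1}-1)P^{N/2}\big)\Big\},$$ where the right-hand side is read as $0$ if $\cos\alpha=0$. (2) Suppose $\cos\alpha\ne0$ and let $$P_c=\Big(\frac{|\tan\alpha|}{2^{N-1}-1}\Big)^{2/N}.$$ If $P_c<1$, then for $P\in[0,1]$ one has $C_{GM}(\rho_N(\alpha,P))=0$ if and only if $P\ge P_c$. If $P_c\ge1$, then for $P\in[0,1]$ one has $C_{GM}(\rho_N(\alpha,P))=0$ if and only if $P=1$. -/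

import Mathlib

noncomputable section

namespace GMConcurrence

/-- Computational basis labels of `N` qubits; `0` is the ground level `g` and `1` the excited
level `e`. -/
abbrev Config (N : ℕ) : Type := Fin N → Fin 2

/-- (Not necessarily normalized) vectors of `(ℂ²)^{⊗N}`, by their coordinates. -/
abbrev Ket (N : ℕ) : Type := Config N → ℂ

/-- Operators on `(ℂ²)^{⊗N}`, by their matrix elements. -/
abbrev Op (N : ℕ) : Type := Matrix (Config N) (Config N) ℂ

/-- The operator `|ψ⟩⟨ψ|`. -/
def proj {N : ℕ} (ψ : Ket N) : Op N := Matrix.vecMulVec ψ (star ψ)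

/-- The vector `ψ` has norm one. -/
def IsUnitKet {N : ℕ} (ψ : Ket N) : Prop := ∑ x, ‖ψ x‖ ^ 2 = 1

/-- The reduced matrix of `ρ` on the qubits in `A`: the qubits outside `A` are traced out. -/
def reduced {N : ℕ} (A : Finset (Fin N)) (ρ : Op N) :
    Matrix ({i // i ∈ A} → Fin 2) ({i // i ∈ A} → Fin 2) ℂ :=
  fun a a' => ∑ b : {i // i ∉ A} → Fin 2,
    ρ ((Equiv.piEquivPiSubtypeProd (· ∈ A) (fun _ => Fin 2)).symm (a, b))
      ((Equiv.piEquivPiSubtypeProd (· ∈ A) (fun _ => Fin 2)).symm (a', b))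

/-- The purity `Tr (ρ_A²)` of the reduced state of `ψ` on `A`. -/
def purity {N : ℕ} (A : Finset (Fin N)) (ψ : Ket N) : ℝ :=
  (Matrix.trace (reduced A (proj ψ) ^ 2)).re

/-- A bipartition `A | Aᶜ` of the `N` qubits into two non-empty parts. An unordered bipartition
occurs twice, once for each part; both parts of a pure state have the same purity. -/
abbrev Bipartition (N : ℕ) : Type := {A : Finset (Fin N) // A.Nonempty ∧ Aᶜ.Nonempty}

/-- Genuinely multipartite concurrence of a pure state: the minimum over all bipartitions
(finitely many, and at least one if `N ≥ 2`) of `√2 √(1 - Tr (ρ_A²))`. -/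
def pureConcurrence {N : ℕ} (ψ : Ket N) : ℝ :=
  ⨅ A : Bipartition N, √2 * √(1 - purity A.1 ψ)

/-- `ρ = ∑ i, p i |ψ i⟩⟨ψ i|` is a pure state decomposition of `ρ`. -/
structure IsPureDecomposition {N m : ℕ} (ρ : Op N) (p : Fin m → ℝ) (ψ : Fin m → Ket N) :
    Prop where
  nonneg : ∀ i, 0 ≤ p i
  sum_eq_one : ∑ i, p i = 1
  unit : ∀ i, IsUnitKet (ψ i)
  eq_sum : ρ = ∑ i, (p i : ℂ) • proj (ψ i)

/-- The average pure state concurrences of all pure state decompositions of `ρ`. -/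
def averageConcurrences {N : ℕ} (ρ : Op N) : Set ℝ :=
  {c | ∃ (m : ℕ) (p : Fin m → ℝ) (ψ : Fin m → Ket N),
    IsPureDecomposition ρ p ψ ∧ c = ∑ i, p i * pureConcurrence (ψ i)}

/-- Genuinely multipartite concurrence of a mixed state: the least average pure state concurrence
over all pure state decompositions. -/
def gmConcurrence {N : ℕ} (ρ : Op N) : ℝ := sInf (averageConcurrences ρ)

/-- The generalized GHZ vector `cos α |e…e⟩ + sin α |g…g⟩`. -/
def ghz (N : ℕ) (α : ℝ) : Ket N :=
  (Real.cos α : ℂ) • Pi.single (fun _ => 1) 1 + (Real.sin α : ℂ) • Pi.single (fun _ => 0) 1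

/-- The Kraus operators of the one-qubit amplitude damping channel with decay probability `P`,
labelled by the final state of the reservoir:
`|g⟩ ↦ |g⟩|0⟩` and `|e⟩ ↦ √(1-P) |e⟩|0⟩ + √P |g⟩|1⟩`. -/
def dampingKraus (P : ℝ) : Fin 2 → Matrix (Fin 2) (Fin 2) ℂ :=
  ![!![1, 0; 0, (√(1 - P) : ℂ)], !![0, (√P : ℂ); 0, 0]]

/-- The tensor product `K_{s 0} ⊗ K_{s 1} ⊗ ⋯` of one-qubit Kraus operators. -/
def localKraus {N : ℕ} (P : ℝ) (s : Fin N → Fin 2) : Op N :=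
  fun x y => ∏ i, dampingKraus P (s i) (x i) (y i)

/-- Each of the `N` qubits passes through its own amplitude damping channel; the reservoirs are
traced out. -/
def localDamping {N : ℕ} (P : ℝ) (ρ : Op N) : Op N :=
  ∑ s : Fin N → Fin 2, localKraus P s * ρ * (localKraus P s).conjTranspose

/-- The state at decay probability `P` of `N` qubits that start in `cos α |e…e⟩ + sin α |g…g⟩`. -/
def dampedGHZ (N : ℕ) (α P : ℝ) : Op N := localDamping P (proj (ghz N α))

/-- The critical decay probability `(|tan α| / (2^(N-1) - 1))^(2/N)`. -/
def criticalP (N : ℕ) (α : ℝ) : ℝ :=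
  (|Real.tan α| / ((2 : ℝ) ^ (N - 1) - 1)) ^ ((2 : ℝ) / (N : ℝ))

end GMConcurrence

end

/-!
The concurrence of a unit vector `ψ` across `A | Aᶜ` is the square root of the sum of the squared
moduli of all two-by-two minors, each taken four times, of the matrix of `ψ` with rows indexed by
the configurations of `A` (`minorSum_eq`). One of these minors, `blockMinor`, involves only the four
configurations that are constant on `A` and on `Aᶜ`; it gives
`C_A(ψ) ≥ 2 |ψ_e ψ_g - ψ_x ψ_x̄|`, where `e`, `g` are the constant configurations, `x` is excited exactly on `A` and `x̄` exactly on `Aᶜ`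
(`le_minorSum`), with equality if `ψ` is supported on these four (`minorSum_of_support`).

*Lower bound.* Subtracting the products of all the pairs `x`, `x̄`, one gets a bound that no longer
depends on `A`. Averaging it over a decomposition of `ρ`, the triangle and Cauchy–Schwarz
inequalities give `C(ρ) ≥ 2 (|ρ_eg| - ∑ √(ρ_xx ρ_x̄x̄))`, the sum being over the `M = 2 ^ (N - 1) - 1`
unordered bipartitions (`averageConcurrence_ge`).

*The state.* The damped state is a mixture of one vector `v`, supported on `e` and `g`, and of
multiples `d_A` of basis vectors, one for each proper subset `A` (`dampedGHZ_eq`). The products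
`√(ρ_xx ρ_x̄x̄)` all have the same value `w`, so that with `z = v_e v_g` the bound reads
`2 (|z| - M w)`.

*Upper bound.* A vector `√β v + √γ (θ d_A ± θ⁻¹ d_Aᶜ)` with `|θ| = 1` is a product across `A | Aᶜ`
if `β |z| = γ w` and the sign is that of `z`; averaging over four phases `θ` yields
`β vv* + γ (d_A d_A* + d_Aᶜ d_Aᶜ*)` (`sum_proj_phases`). With the largest possible weights
(`exists_weights`) the part of `v` that is left over has concurrence `2 max 0 (|z| - M w)`, and the
decayed vectors that are left over are products (`exists_optimal_decomposition`).

The statements about the critical decay probability are read off from this formula.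
-/

open Finset

namespace GMConcurrence

/-! ### Concurrence across a bipartition as a sum of two-by-two minors -/

/-- The configuration that is constantly `a` on the qubits in `A` and constantly `b` outside. -/
def block {N : ℕ} (A : Finset (Fin N)) (a b : Fin 2) : Config N := fun i => if i ∈ A then a else b

/-- The configuration that agrees with `x` on the qubits in `A` and with `y` outside. -/
def mix {N : ℕ} (A : Finset (Fin N)) (x y : Config N) : Config N :=
  fun i => if i ∈ A then x i else y i

/-- The squared norm of a ket. -/
noncomputable def normSq {N : ℕ} (φ : Ket N) : ℝ := ∑ x, ‖φ x‖ ^ 2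

/-- The sum of the squared moduli of all two-by-two minors of `φ`, seen as a matrix with rows
indexed by the configurations of `A` and columns by those of `Aᶜ`. The two configurations `x` and
`y` name two rows and two columns at once, so every minor is counted four times. -/
noncomputable def minorSum {N : ℕ} (A : Finset (Fin N)) (φ : Ket N) : ℝ :=
  ∑ x, ∑ y, ‖φ x * φ y - φ (mix A x y) * φ (mix A y x)‖ ^ 2

variable {N : ℕ}

lemma block_self (A : Finset (Fin N)) (a : Fin 2) : block A a a = fun _ => a := by
  funext i; simp [block]

lemma block_compl (A : Finset (Fin N)) (a b : Fin 2) : block Aᶜ a b = block A b a := by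
  funext i; by_cases h : i ∈ A <;> simp [block, h]

lemma mix_block (A : Finset (Fin N)) (a b a' b' : Fin 2) :
    mix A (block A a b) (block A a' b') = block A a b' := by
  funext i; by_cases h : i ∈ A <;> simp [block, mix, h]

lemma mix_mix (A : Finset (Fin N)) (x y : Config N) : mix A (mix A x y) (mix A y x) = x := by
  funext i; by_cases h : i ∈ A <;> simp [mix, h]

/-- Exchanging the parts outside `A` of two configurations, as a permutation of pairs. -/
def mixEquiv (A : Finset (Fin N)) : Config N × Config N ≃ Config N × Config N where
  toFun p := (mix A p.1 p.2, mix A p.2 p.1)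
  invFun p := (mix A p.1 p.2, mix A p.2 p.1)
  left_inv p := by simp [mix_mix]
  right_inv p := by simp [mix_mix]

lemma block_injective (A : Bipartition N) {a b a' b' : Fin 2}
    (h : block A.1 a b = block A.1 a' b') : a = a' ∧ b = b' := by
  obtain ⟨i, hi⟩ := A.2.1
  obtain ⟨j, hj⟩ := A.2.2
  have h1 := congrFun h i
  have h2 := congrFun h j
  rw [mem_compl] at hj
  simp only [block, hi, hj, if_true, if_false] at h1 h2
  exact ⟨h1, h2⟩

lemma trace_reduced_sq (A : Finset (Fin N)) (φ : Ket N) :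
    Matrix.trace (reduced A (proj φ) ^ 2) =
      ∑ x, ∑ y, φ x * φ y * star (φ (mix A x y) * φ (mix A y x)) := by
  set E := (Equiv.piEquivPiSubtypeProd (· ∈ A) (fun _ : Fin N => Fin 2)).symm with hE
  have hmix : ∀ a b a' b', mix A (E (a, b)) (E (a', b')) = E (a, b') := by
    intro a b a' b'
    funext i
    by_cases h : i ∈ A <;> simp [mix, hE, h]
  have h1 : ∀ x : Config N, ∑ y, φ x * φ y * star (φ (mix A x y) * φ (mix A y x)) =
      ∑ p, φ x * φ (E p) * star (φ (mix A x (E p)) * φ (mix A (E p) x)) :=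
    fun x => (E.sum_comp _).symm
  simp_rw [h1]
  rw [← E.sum_comp]
  simp only [Fintype.sum_prod_type, hmix]
  simp only [Matrix.trace, Matrix.diag, pow_two, Matrix.mul_apply, reduced, ← hE, proj,
    Matrix.vecMulVec_apply, Pi.star_apply, Finset.sum_mul_sum]
  refine Finset.sum_congr rfl fun a _ => ?_
  rw [Finset.sum_comm]
  refine Finset.sum_congr rfl fun b _ => Finset.sum_congr rfl fun a' _ =>
    Finset.sum_congr rfl fun b' _ => ?_
  rw [star_mul]
  ring

/-- The minors measure the linear entropy of the reduced state. With `w` the product of the two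
mixed amplitudes, `‖z - w‖² = ‖z‖² + ‖w‖² - 2 Re (z w̄)`, and the first two terms have the same sum
because mixing permutes the pairs of configurations. -/
lemma minorSum_eq (A : Finset (Fin N)) (φ : Ket N) :
    minorSum A φ = 2 * (normSq φ ^ 2 - purity A φ) := by
  have hswap : ∑ x, ∑ y, ‖φ (mix A x y) * φ (mix A y x)‖ ^ 2 = ∑ x, ∑ y, ‖φ x * φ y‖ ^ 2 := by
    simp only [← Fintype.sum_prod_type']
    exact (mixEquiv A).sum_comp (fun p : Config N × Config N => ‖φ p.1 * φ p.2‖ ^ 2)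
  have hsq : ∑ x, ∑ y, ‖φ x * φ y‖ ^ 2 = normSq φ ^ 2 := by
    rw [normSq, pow_two (∑ x, _), Finset.sum_mul_sum]
    simp only [norm_mul, mul_pow]
  have hexp : ∀ z w : ℂ, ‖z - w‖ ^ 2 = ‖z‖ ^ 2 + ‖w‖ ^ 2 - 2 * (z * star w).re := by
    intro z w
    simp only [← Complex.normSq_eq_norm_sq]
    rw [Complex.normSq_sub]
    rfl
  rw [purity, trace_reduced_sq, minorSum]
  simp only [hexp, Finset.sum_sub_distrib, Finset.sum_add_distrib, hswap, hsq, Complex.re_sum,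
    ← Finset.mul_sum]
  ring

lemma minorSum_smul (A : Finset (Fin N)) (r : ℝ) (φ : Ket N) :
    minorSum A ((r : ℂ) • φ) = (r ^ 2) ^ 2 * minorSum A φ := by
  simp only [minorSum, Finset.mul_sum]
  refine Finset.sum_congr rfl fun x _ => Finset.sum_congr rfl fun y _ => ?_
  simp only [Pi.smul_apply, smul_eq_mul]
  rw [show (r : ℂ) * φ x * (r * φ y) - r * φ (mix A x y) * (r * φ (mix A y x)) =
    (r : ℂ) ^ 2 * (φ x * φ y - φ (mix A x y) * φ (mix A y x)) by ring, norm_mul, mul_pow, norm_pow,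
    Complex.norm_real, Real.norm_eq_abs, sq_abs]

lemma sqrt_one_sub_purity (A : Finset (Fin N)) {ψ : Ket N} (h : IsUnitKet ψ) :
    √2 * √(1 - purity A ψ) = √(minorSum A ψ) := by
  have h1 : normSq ψ = 1 := h
  rw [minorSum_eq, h1, one_pow, Real.sqrt_mul (by norm_num)]

/-- The pairs of configurations that are constant on `A` and on `Aᶜ`. -/
def blockPair (A : Finset (Fin N)) (p : (Fin 2 × Fin 2) × (Fin 2 × Fin 2)) :
    Config N × Config N := (block A p.1.1 p.1.2, block A p.2.1 p.2.2)

lemma blockPair_injective (A : Bipartition N) : Function.Injective (blockPair A.1) := by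
  rintro ⟨⟨a, b⟩, ⟨c, d⟩⟩ ⟨⟨a', b'⟩, ⟨c', d'⟩⟩ h
  simp only [blockPair, Prod.mk.injEq] at h ⊢
  exact ⟨block_injective A h.1, block_injective A h.2⟩

/-- The one minor, up to sign, that involves only configurations constant on `A` and on `Aᶜ`. -/
def blockMinor (A : Finset (Fin N)) (φ : Ket N) : ℂ :=
  φ (block A 1 1) * φ (block A 0 0) - φ (block A 1 0) * φ (block A 0 1)

lemma sum_blockPair (A : Finset (Fin N)) (φ : Ket N) :
    ∑ p, ‖φ (blockPair A p).1 * φ (blockPair A p).2 -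
      φ (mix A (blockPair A p).1 (blockPair A p).2) *
        φ (mix A (blockPair A p).2 (blockPair A p).1)‖ ^ 2 = 4 * ‖blockMinor A φ‖ ^ 2 := by
  have e1 : ‖φ (block A 1 0) * φ (block A 0 1) - φ (block A 1 1) * φ (block A 0 0)‖ =
      ‖blockMinor A φ‖ := norm_sub_rev _ _
  have e2 : ‖φ (block A 0 0) * φ (block A 1 1) - φ (block A 0 1) * φ (block A 1 0)‖ =
      ‖blockMinor A φ‖ := by rw [blockMinor]; congr 1; ring
  have e3 : ‖φ (block A 0 1) * φ (block A 1 0) - φ (block A 0 0) * φ (block A 1 1)‖ =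
      ‖blockMinor A φ‖ := by rw [norm_sub_rev, e2]
  have e4 : ‖φ (block A 1 1) * φ (block A 0 0) - φ (block A 1 0) * φ (block A 0 1)‖ =
      ‖blockMinor A φ‖ := rfl
  have e5 : ∀ z w : ℂ, ‖z * w - w * z‖ ^ 2 = 0 := by
    intro z w; rw [mul_comm, sub_self]; simp
  simp only [Fintype.sum_prod_type, Fin.sum_univ_two, blockPair, mix_block, e1, e2, e3, e4, e5,
    sub_self, norm_zero]
  ring

/-- The block minor occurs four times in the sum of all minors; the bipartition being proper makes
these occurrences distinct. -/
lemma le_minorSum (A : Bipartition N) (φ : Ket N) :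
    (2 * ‖blockMinor A.1 φ‖) ^ 2 ≤ minorSum A.1 φ := by
  rw [mul_pow, show (2 : ℝ) ^ 2 = 4 by norm_num, ← sum_blockPair, minorSum,
    ← Fintype.sum_prod_type']
  rw [← Finset.sum_image (f := fun p : Config N × Config N =>
    ‖φ p.1 * φ p.2 - φ (mix A.1 p.1 p.2) * φ (mix A.1 p.2 p.1)‖ ^ 2) (g := blockPair A.1)
    ((blockPair_injective A).injOn)]
  exact Finset.sum_le_sum_of_subset_of_nonneg (Finset.subset_univ _) fun _ _ _ => by positivity

/-- For a vector supported on the four block configurations no other minor contributes. -/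
lemma minorSum_of_support (A : Bipartition N) (φ : Ket N)
    (hφ : ∀ x, φ x ≠ 0 → ∃ a b, x = block A.1 a b) :
    minorSum A.1 φ = (2 * ‖blockMinor A.1 φ‖) ^ 2 := by
  rw [mul_pow, show (2 : ℝ) ^ 2 = 4 by norm_num, ← sum_blockPair, minorSum,
    ← Fintype.sum_prod_type']
  symm
  refine Fintype.sum_of_injective _ (blockPair_injective A) _ _ ?_ fun _ => rfl
  rintro ⟨x, y⟩ hxy
  have key : ∀ x y : Config N, φ x * φ y ≠ 0 → ∃ p, blockPair A.1 p = (x, y) := by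
    intro x y h
    obtain ⟨a, b, rfl⟩ := hφ x (left_ne_zero_of_mul h)
    obtain ⟨c, d, rfl⟩ := hφ y (right_ne_zero_of_mul h)
    exact ⟨((a, b), (c, d)), rfl⟩
  have h1 : φ x * φ y = 0 := by
    by_contra h
    exact hxy (key x y h)
  have h2 : φ (mix A.1 x y) * φ (mix A.1 y x) = 0 := by
    by_contra h
    obtain ⟨⟨⟨a, b⟩, ⟨c, d⟩⟩, hp⟩ := key _ _ h
    simp only [blockPair, Prod.mk.injEq] at hp
    refine hxy ⟨((a, d), (c, b)), ?_⟩
    simp only [blockPair, Prod.mk.injEq]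
    rw [← mix_mix A.1 x y, ← hp.1, ← hp.2, mix_block]
    refine ⟨rfl, ?_⟩
    rw [← mix_mix A.1 y x, ← hp.1, ← hp.2, mix_block]
  simp [h1, h2]

/-! ### Bounds on the convex roof -/

lemma pureConcurrence_nonneg (ψ : Ket N) : 0 ≤ pureConcurrence ψ :=
  Real.iInf_nonneg fun _ => by positivity

lemma pureConcurrence_le (A : Bipartition N) {ψ : Ket N} (h : IsUnitKet ψ) :
    pureConcurrence ψ ≤ √(minorSum A.1 ψ) := by
  rw [← sqrt_one_sub_purity _ h]
  exact ciInf_le ⟨0, by rintro _ ⟨B, rfl⟩; positivity⟩ A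

/-- The bipartition with the two parts exchanged. -/
def Bipartition.compl (A : Bipartition N) : Bipartition N :=
  ⟨A.1ᶜ, A.2.2, by rw [compl_compl]; exact A.2.1⟩

/-- Exchanging the two parts, as a permutation of the bipartitions. -/
def complEquiv : Bipartition N ≃ Bipartition N where
  toFun := Bipartition.compl
  invFun := Bipartition.compl
  left_inv A := Subtype.ext (compl_compl A.1)
  right_inv A := Subtype.ext (compl_compl A.1)

lemma Bipartition.ne_univ (A : Bipartition N) : univ ≠ A.1 := by
  intro h
  have := A.2.2
  rw [← h, compl_univ] at this
  exact not_nonempty_empty this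

lemma Bipartition.ne_empty (A : Bipartition N) : ∅ ≠ A.1 := A.2.1.ne_empty.symm

lemma Bipartition.ne_compl (A : Bipartition N) : A.1 ≠ A.1ᶜ := by
  intro h
  obtain ⟨i, hi⟩ := A.2.1
  exact mem_compl.1 (h ▸ hi : i ∈ A.1ᶜ) hi

lemma exists_bipartition (hN : 2 ≤ N) : Nonempty (Bipartition N) := by
  refine ⟨⟨{⟨0, by omega⟩}, singleton_nonempty _, ⟨1, by omega⟩, ?_⟩⟩
  simp

/-- The block minor of any one bipartition bounds the concurrence across it from below, and the
products of amplitudes of the other bipartitions are merely subtracted in addition. Each bipartition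
occurs in the sum together with its complement, which accounts for the missing factor `2`. -/
lemma le_pureConcurrence (hN : 2 ≤ N) {ψ : Ket N} (h : IsUnitKet ψ) :
    2 * (‖ψ fun _ => 1‖ * ‖ψ fun _ => 0‖) -
      ∑ A : Bipartition N, ‖ψ (block A.1 1 0)‖ * ‖ψ (block A.1 0 1)‖ ≤ pureConcurrence ψ := by
  have := exists_bipartition hN
  refine le_ciInf fun A => ?_
  rw [sqrt_one_sub_purity _ h]
  refine le_trans ?_ (Real.le_sqrt_of_sq_le (le_minorSum A ψ))
  have h1 : ‖ψ fun _ => 1‖ * ‖ψ fun _ => 0‖ - ‖ψ (block A.1 1 0)‖ * ‖ψ (block A.1 0 1)‖ ≤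
      ‖blockMinor A.1 ψ‖ := by
    rw [blockMinor, block_self, block_self, ← norm_mul, ← norm_mul]
    exact norm_sub_norm_le _ _
  have h2 : 2 * (‖ψ (block A.1 1 0)‖ * ‖ψ (block A.1 0 1)‖) ≤
      ∑ B : Bipartition N, ‖ψ (block B.1 1 0)‖ * ‖ψ (block B.1 0 1)‖ := by
    calc _ = ∑ B ∈ {A, A.compl}, ‖ψ (block B.1 1 0)‖ * ‖ψ (block B.1 0 1)‖ := by
          rw [Finset.sum_pair fun h => A.ne_compl (congrArg Subtype.val h)]
          simp only [Bipartition.compl, block_compl]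
          ring
      _ ≤ _ := Finset.sum_le_sum_of_subset_of_nonneg (Finset.subset_univ _)
          fun _ _ _ => by positivity
  linarith

lemma proj_apply (φ : Ket N) (x y : Config N) : proj φ x y = φ x * star (φ y) := rfl

lemma proj_smul (r : ℂ) (φ : Ket N) : proj (r • φ) = (r * star r) • proj φ := by
  ext x y
  simp only [proj_apply, Pi.smul_apply, smul_eq_mul, star_mul, Matrix.smul_apply]
  ring

/-- The lower bound, from the matrix elements of the state alone: average `le_pureConcurrence` over
a decomposition, with the triangle inequality for the coherence between the two constant
configurations and the Cauchy–Schwarz inequality for the products of the other amplitudes. -/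
lemma averageConcurrence_ge (hN : 2 ≤ N) {ρ : Op N} {c : ℝ} (hc : c ∈ averageConcurrences ρ) :
    2 * ‖ρ (fun _ => 1) (fun _ => 0)‖ - ∑ A : Bipartition N,
      √(ρ (block A.1 1 0) (block A.1 1 0)).re * √(ρ (block A.1 0 1) (block A.1 0 1)).re ≤ c := by
  obtain ⟨m, p, ψ, hd, rfl⟩ := hc
  have happ : ∀ x y, ρ x y = ∑ i, (p i : ℂ) * (ψ i x * star (ψ i y)) := by
    intro x y
    rw [hd.eq_sum, Matrix.sum_apply]
    rfl
  have hdiag : ∀ x, (ρ x x).re = ∑ i, (√(p i) * ‖ψ i x‖) ^ 2 := by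
    intro x
    rw [happ, Complex.re_sum]
    refine Finset.sum_congr rfl fun i _ => ?_
    rw [mul_pow, Real.sq_sqrt (hd.nonneg i), Complex.re_ofReal_mul, Complex.star_def,
      Complex.mul_conj, Complex.ofReal_re, Complex.normSq_eq_norm_sq]
  have hoff : ‖ρ (fun _ => 1) (fun _ => 0)‖ ≤
      ∑ i, p i * (‖ψ i fun _ => 1‖ * ‖ψ i fun _ => 0‖) := by
    rw [happ]
    refine (norm_sum_le _ _).trans (le_of_eq (Finset.sum_congr rfl fun i _ => ?_))
    rw [norm_mul, norm_mul, norm_star, Complex.norm_real, Real.norm_of_nonneg (hd.nonneg i)]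
  have hcs : ∀ A : Bipartition N,
      ∑ i, p i * (‖ψ i (block A.1 1 0)‖ * ‖ψ i (block A.1 0 1)‖) ≤
      √(ρ (block A.1 1 0) (block A.1 1 0)).re * √(ρ (block A.1 0 1) (block A.1 0 1)).re := by
    intro A
    rw [hdiag, hdiag]
    refine le_trans (le_of_eq (Finset.sum_congr rfl fun i _ => ?_))
      (Real.sum_mul_le_sqrt_mul_sqrt _ _ _)
    -- Each factor of the Cauchy–Schwarz inequality receives one of the two square roots of `p i`.
    nth_rewrite 1 [← Real.mul_self_sqrt (hd.nonneg i)]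
    ring
  calc _ ≤ 2 * ∑ i, p i * (‖ψ i fun _ => 1‖ * ‖ψ i fun _ => 0‖) - ∑ A : Bipartition N,
        ∑ i, p i * (‖ψ i (block A.1 1 0)‖ * ‖ψ i (block A.1 0 1)‖) :=
        sub_le_sub (by linarith) (Finset.sum_le_sum fun A _ => hcs A)
    _ = ∑ i, p i * (2 * (‖ψ i fun _ => 1‖ * ‖ψ i fun _ => 0‖) -
        ∑ A : Bipartition N, ‖ψ i (block A.1 1 0)‖ * ‖ψ i (block A.1 0 1)‖) := by
        rw [Finset.sum_comm, Finset.mul_sum, ← Finset.sum_sub_distrib]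
        refine Finset.sum_congr rfl fun i _ => ?_
        rw [← Finset.mul_sum]
        ring
    _ ≤ _ := Finset.sum_le_sum fun i _ =>
        mul_le_mul_of_nonneg_left (le_pureConcurrence hN (hd.unit i)) (hd.nonneg i)

lemma averageConcurrence_nonneg {ρ : Op N} {c : ℝ} (hc : c ∈ averageConcurrences ρ) : 0 ≤ c := by
  obtain ⟨m, p, ψ, hd, rfl⟩ := hc
  exact Finset.sum_nonneg fun i _ => mul_nonneg (hd.nonneg i) (pureConcurrence_nonneg _)

lemma normSq_nonneg (φ : Ket N) : 0 ≤ normSq φ := Finset.sum_nonneg fun _ _ => by positivity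

lemma normSq_smul (r : ℝ) (φ : Ket N) : normSq ((r : ℂ) • φ) = r ^ 2 * normSq φ := by
  simp only [normSq, Pi.smul_apply, smul_eq_mul, norm_mul, mul_pow, Complex.norm_real,
    Real.norm_eq_abs, sq_abs, Finset.mul_sum]

lemma eq_zero_of_normSq_eq_zero {φ : Ket N} (h : normSq φ = 0) : φ = 0 := by
  funext x
  have := (Finset.sum_eq_zero_iff_of_nonneg (fun _ _ => by positivity)).1 h x (mem_univ x)
  simpa using this

/-- A vector is its norm times a unit vector. -/
lemma exists_unit (φ : Ket N) : ∃ ψ : Ket N, IsUnitKet ψ ∧ φ = (√(normSq φ) : ℂ) • ψ := by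
  by_cases h : normSq φ = 0
  · refine ⟨Pi.single 0 1, ?_, ?_⟩
    · rw [IsUnitKet, Finset.sum_eq_single 0]
      · simp
      · intro b _ hb
        simp [hb]
      · simp
    · rw [h, eq_zero_of_normSq_eq_zero h]
      simp
  · have h0 : √(normSq φ) ≠ 0 := by
      rw [Real.sqrt_ne_zero']
      exact lt_of_le_of_ne (normSq_nonneg φ) (Ne.symm h)
    refine ⟨((√(normSq φ))⁻¹ : ℝ) • φ, ?_, ?_⟩
    · change normSq _ = 1
      have := normSq_smul (√(normSq φ))⁻¹ φ
      rw [inv_pow, Real.sq_sqrt (normSq_nonneg φ), inv_mul_cancel₀ h] at this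
      rw [← this]
      congr 1
    · ext x
      simp only [Pi.smul_apply, smul_eq_mul, Complex.real_smul]
      rw [← mul_assoc, ← Complex.ofReal_mul, mul_inv_cancel₀ h0]
      simp

/-- Subnormalized vectors whose projectors sum to a state of trace one give a pure state
decomposition; the average concurrence may be estimated with any choice of one bipartition for
each vector. -/
lemma exists_averageConcurrence_le {ι : Type*} [Fintype ι] (φ : ι → Ket N)
    (A : ι → Bipartition N) (h1 : ∑ i, normSq (φ i) = 1) :
    ∃ c ∈ averageConcurrences (∑ i, proj (φ i)), c ≤ ∑ i, √(minorSum (A i).1 (φ i)) := by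
  choose ψ hψ hφ using fun i => exists_unit (φ i)
  let e := Fintype.equivFin ι
  refine ⟨_, ⟨Fintype.card ι, fun j => normSq (φ (e.symm j)), fun j => ψ (e.symm j),
    ⟨fun _ => normSq_nonneg _, ?_, fun _ => hψ _, ?_⟩, rfl⟩, ?_⟩
  · rw [← h1]
    exact e.symm.sum_comp fun i => normSq (φ i)
  · rw [e.symm.sum_comp fun i => (normSq (φ i) : ℂ) • proj (ψ i)]
    refine Finset.sum_congr rfl fun i _ => ?_
    nth_rewrite 1 [hφ i]
    rw [proj_smul, Complex.star_def, Complex.conj_ofReal, ← Complex.ofReal_mul,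
      Real.mul_self_sqrt (normSq_nonneg _)]
  · rw [e.symm.sum_comp fun i => normSq (φ i) * pureConcurrence (ψ i)]
    refine Finset.sum_le_sum fun i _ => ?_
    nth_rewrite 2 [hφ i]
    rw [minorSum_smul, Real.sq_sqrt (normSq_nonneg _),
      Real.sqrt_mul (by positivity), Real.sqrt_sq (normSq_nonneg _)]
    exact mul_le_mul_of_nonneg_left (pureConcurrence_le _ (hψ i)) (normSq_nonneg _)

/-- Attainment is deduced from a lower bound that some decomposition reaches, which also rules out
the junk value of an infimum of reals. -/
lemma gmConcurrence_eq_of_le {ρ : Op N} {c L : ℝ} (hL : ∀ c ∈ averageConcurrences ρ, L ≤ c)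
    (hc : c ∈ averageConcurrences ρ) (hcL : c ≤ L) :
    gmConcurrence ρ ∈ averageConcurrences ρ ∧ gmConcurrence ρ = L := by
  obtain rfl : c = L := le_antisymm hcL (hL c hc)
  have : gmConcurrence ρ = c := IsLeast.csInf_eq ⟨hc, hL⟩
  exact ⟨this ▸ hc, this⟩

/-! ### The damped state -/

/-- The amplitude with which exactly the qubits in `S` stay excited, when all start excited. -/
noncomputable def survival (P : ℝ) (S : Finset (Fin N)) : ℝ := √(1 - P) ^ #S * √P ^ (N - #S)

/-- The basis vector with the qubits in `S` excited and the others in the ground level. -/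
def basisKet (S : Finset (Fin N)) : Ket N := Pi.single (block S 1 0) 1

lemma block_eq_iff {S T : Finset (Fin N)} : block S 1 0 = block T 1 0 ↔ S = T := by
  refine ⟨fun h => ?_, fun h => h ▸ rfl⟩
  ext i
  have := congrFun h i
  by_cases h1 : i ∈ S <;> by_cases h2 : i ∈ T <;> simp_all [block]

lemma basisKet_block (S T : Finset (Fin N)) :
    basisKet S (block T 1 0) = if S = T then 1 else 0 := by
  simp only [basisKet, Pi.single_apply, block_eq_iff, eq_comm]

lemma sum_config {M : Type*} [AddCommMonoid M] (f : Config N → M) :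
    ∑ x, f x = ∑ S : Finset (Fin N), f (block S 1 0) := by
  symm
  refine Function.Bijective.sum_comp ⟨fun S T h => block_eq_iff.1 h, fun x => ?_⟩ f
  refine ⟨Finset.univ.filter (fun i => x i = 1), ?_⟩
  funext i
  by_cases h : x i = 1
  · simp [block, h]
  · simp only [block, mem_filter, mem_univ, true_and, h, if_false]
    omega

lemma univ_ne_empty (hN : 2 ≤ N) : (univ : Finset (Fin N)) ≠ ∅ := by
  have : Nonempty (Fin N) := ⟨⟨0, by omega⟩⟩
  exact univ_nonempty.ne_empty

lemma sum_finset (hN : 2 ≤ N) {M : Type*} [AddCommMonoid M] (f : Finset (Fin N) → M) :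
    ∑ S, f S = f univ + f ∅ + ∑ A : Bipartition N, f A.1 := by
  rw [← Finset.sum_pair (univ_ne_empty hN), ← Finset.sum_compl_add_sum {univ, ∅}, add_comm]
  congr 1
  refine Finset.sum_subtype _ (fun S => ?_) f
  simp only [mem_compl, mem_insert, mem_singleton, not_or, nonempty_iff_ne_empty, ne_eq,
    compl_eq_empty_iff]
  tauto

lemma card_bipartition (hN : 2 ≤ N) :
    (Fintype.card (Bipartition N) : ℝ) = 2 * ((2 : ℝ) ^ (N - 1) - 1) := by
  have h := sum_finset hN (fun _ => (1 : ℝ))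
  obtain ⟨n, rfl⟩ : ∃ n, N = n + 1 := ⟨N - 1, by omega⟩
  simp only [sum_const, card_univ, Fintype.card_finset, Fintype.card_fin, nsmul_eq_mul,
    mul_one] at h
  push_cast at h
  simp only [Nat.add_sub_cancel]
  rw [pow_succ] at h
  linarith

lemma prod_ite_eq_survival (P : ℝ) (S : Finset (Fin N)) :
    ∏ i, (if i ∈ S then (√(1 - P) : ℂ) else (√P : ℂ)) = survival P S := by
  rw [Finset.prod_ite, Finset.prod_const, Finset.prod_const, survival]
  have h1 : #{i | i ∈ S} = #S := by congr 1; ext; simp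
  have h2 : #{i | i ∉ S} = N - #S := by
    rw [← compl_filter, card_compl, h1, Fintype.card_fin]
  rw [h1, h2]
  push_cast
  rfl

/-- If the reservoirs record a decay exactly of the qubits outside `S`, the excited register is
sent to the basis vector of `S`. -/
lemma localKraus_excited (P : ℝ) (S : Finset (Fin N)) (x : Config N) :
    localKraus P (block S 0 1) x (fun _ => 1) = (survival P S : ℂ) * basisKet S x := by
  by_cases h : x = block S 1 0
  · subst h
    rw [basisKet_block, if_pos rfl, mul_one, ← prod_ite_eq_survival, localKraus]
    refine Finset.prod_congr rfl fun i _ => ?_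
    by_cases hi : i ∈ S <;> simp [block, hi, dampingKraus]
  · rw [basisKet, Pi.single_eq_of_ne h, mul_zero]
    obtain ⟨i, hi⟩ := Function.ne_iff.1 h
    refine Finset.prod_eq_zero (mem_univ i) ?_
    generalize x i = a at hi
    by_cases hS : i ∈ S <;> fin_cases a <;> simp_all [block, dampingKraus]

/-- The ground register triggers no decay, so it is compatible with the empty record only. -/
lemma localKraus_ground (P : ℝ) (S : Finset (Fin N)) (x : Config N) :
    localKraus P (block S 0 1) x (fun _ => 0) = if S = univ then basisKet ∅ x else 0 := by
  split_ifs with hS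
  · subst hS
    by_cases h : x = block ∅ 1 0
    · subst h
      rw [basisKet_block, if_pos rfl, localKraus]
      simp [block, dampingKraus]
    · rw [basisKet, Pi.single_eq_of_ne h]
      obtain ⟨i, hi⟩ := Function.ne_iff.1 h
      refine Finset.prod_eq_zero (mem_univ i) ?_
      generalize x i = a at hi
      fin_cases a <;> simp_all [block, dampingKraus]
  · obtain ⟨i, hi⟩ : ∃ i, i ∉ S := by simpa [Finset.eq_univ_iff_forall] using hS
    refine Finset.prod_eq_zero (mem_univ i) ?_
    generalize x i = a
    fin_cases a <;> simp [block, dampingKraus, hi]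

/-- The vector that remains when no qubit decays. -/
noncomputable def undecayed (N : ℕ) (α P : ℝ) : Ket N :=
  ((Real.cos α * survival P (univ : Finset (Fin N)) : ℝ) : ℂ) • basisKet univ +
    (Real.sin α : ℂ) • basisKet ∅

/-- The vector that remains when exactly the qubits outside `S` decay. -/
noncomputable def decayed (α P : ℝ) (S : Finset (Fin N)) : Ket N :=
  ((Real.cos α * survival P S : ℝ) : ℂ) • basisKet S

lemma localKraus_mulVec_ghz (α P : ℝ) (S : Finset (Fin N)) :
    (localKraus P (block S 0 1)).mulVec (ghz N α) =
      if S = univ then undecayed N α P else decayed α P S := by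
  funext x
  rw [ghz, Matrix.mulVec_add, Matrix.mulVec_smul, Matrix.mulVec_smul, Matrix.mulVec_single_one,
    Matrix.mulVec_single_one]
  simp only [Pi.add_apply, Pi.smul_apply, smul_eq_mul, Matrix.col_apply, localKraus_excited,
    localKraus_ground]
  split_ifs with hS
  · subst hS
    simp only [undecayed, Pi.add_apply, Pi.smul_apply, smul_eq_mul]
    push_cast
    ring
  · simp only [decayed, Pi.smul_apply, smul_eq_mul]
    push_cast
    ring

/-- The damped state as a mixture over the records of the reservoirs. Coherence survives only in
the vector without decays, as each other record occurs with one initial basis vector only. -/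
lemma dampedGHZ_eq (hN : 2 ≤ N) (α P : ℝ) :
    dampedGHZ N α P = proj (undecayed N α P) + proj (decayed α P ∅) +
      ∑ A : Bipartition N, proj (decayed α P A.1) := by
  have hconj : ∀ s : Fin N → Fin 2, localKraus P s * proj (ghz N α) *
      (localKraus P s).conjTranspose = proj ((localKraus P s).mulVec (ghz N α)) := by
    intro s
    rw [proj, proj, Matrix.mul_vecMulVec, Matrix.vecMulVec_mul, Matrix.star_mulVec]
  have hA : ∀ A : Bipartition N, A.1 ≠ univ := fun A => A.ne_univ.symm
  rw [dampedGHZ, localDamping]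
  simp only [hconj]
  -- The records are indexed by the set of qubits that stay excited, not by those that decay.
  rw [sum_config, ← (Equiv.mk compl compl compl_compl compl_compl :
    Finset (Fin N) ≃ Finset (Fin N)).sum_comp]
  simp only [Equiv.coe_fn_mk, block_compl, localKraus_mulVec_ghz]
  rw [sum_finset hN, if_pos rfl, if_neg (univ_ne_empty hN).symm]
  simp only [if_neg (hA _)]

/-- The product does not depend on `S`: all bipartitions weigh the same in the lower bound. -/
lemma survival_mul_survival_compl (P : ℝ) (S : Finset (Fin N)) :
    survival P S * survival P Sᶜ = (√(1 - P) * √P) ^ N := by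
  have h : #S ≤ N := by simpa using card_le_univ S
  rw [survival, survival, card_compl, Fintype.card_fin, Nat.sub_sub_self h]
  calc _ = (√(1 - P) ^ #S * √(1 - P) ^ (N - #S)) * (√P ^ #S * √P ^ (N - #S)) := by ring
    _ = _ := by rw [← pow_add, ← pow_add, Nat.add_sub_cancel' h, mul_pow]

lemma survival_nonneg (P : ℝ) (S : Finset (Fin N)) : 0 ≤ survival P S := by
  unfold survival; positivity

lemma survival_univ (P : ℝ) : survival P (univ : Finset (Fin N)) = √(1 - P) ^ N := by
  simp [survival]

lemma sum_survival_sq {P : ℝ} (h0 : 0 ≤ P) (h1 : P ≤ 1) :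
    ∑ S : Finset (Fin N), survival P S ^ 2 = 1 := by
  have h := Fintype.sum_pow_mul_eq_add_pow (Fin N) (1 - P) P
  rw [sub_add_cancel, one_pow, Fintype.card_fin] at h
  rw [← h]
  refine Finset.sum_congr rfl fun S _ => ?_
  rw [survival, mul_pow, ← pow_mul, ← pow_mul, mul_comm _ 2, mul_comm _ 2, pow_mul, pow_mul,
    Real.sq_sqrt (by linarith), Real.sq_sqrt h0]

lemma normSq_decayed (α P : ℝ) (S : Finset (Fin N)) :
    normSq (decayed α P S) = Real.cos α ^ 2 * survival P S ^ 2 := by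
  rw [decayed, normSq_smul, normSq, sum_config, Finset.sum_eq_single S]
  · simp [basisKet_block, mul_pow]
  · intro T _ hT
    simp [basisKet_block, hT.symm]
  · simp

lemma normSq_undecayed (hN : 2 ≤ N) (α P : ℝ) :
    normSq (undecayed N α P) =
      Real.cos α ^ 2 * survival P (univ : Finset (Fin N)) ^ 2 + Real.sin α ^ 2 := by
  have h : ∀ S : Finset (Fin N), ‖undecayed N α P (block S 1 0)‖ ^ 2 =
      (if univ = S then (Real.cos α * survival P (univ : Finset (Fin N))) ^ 2 else 0) +
        (if ∅ = S then Real.sin α ^ 2 else 0) := by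
    intro S
    simp only [undecayed, Pi.add_apply, Pi.smul_apply, smul_eq_mul, basisKet_block]
    by_cases h1 : univ = S
    · subst h1
      rw [if_pos rfl, if_pos rfl, if_neg (univ_ne_empty hN).symm,
        if_neg (univ_ne_empty hN).symm, mul_one, mul_zero, add_zero, Complex.norm_real,
        Real.norm_eq_abs, sq_abs, add_zero]
    · rw [if_neg h1, if_neg h1, mul_zero, zero_add, zero_add]
      split_ifs
      · rw [mul_one, Complex.norm_real, Real.norm_eq_abs, sq_abs]
      · simp
  rw [normSq, sum_config]
  simp only [h, Finset.sum_add_distrib, Finset.sum_ite_eq, mem_univ, if_true, mul_pow]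

/-- Damping preserves the trace. -/
lemma normSq_undecayed_add (hN : 2 ≤ N) (α : ℝ) {P : ℝ} (h0 : 0 ≤ P) (h1 : P ≤ 1) :
    normSq (undecayed N α P) + normSq (decayed α P (∅ : Finset (Fin N))) +
      ∑ A : Bipartition N, normSq (decayed α P A.1) = 1 := by
  have h := sum_finset hN (fun S => Real.cos α ^ 2 * survival P S ^ 2)
  rw [← Finset.mul_sum, sum_survival_sq h0 h1] at h
  simp only [normSq_decayed, normSq_undecayed hN]
  have := Real.sin_sq_add_cos_sq α
  linarith

lemma undecayed_apply (α P : ℝ) (S : Finset (Fin N)) : undecayed N α P (block S 1 0) =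
    (if univ = S then ((Real.cos α * survival P (univ : Finset (Fin N)) : ℝ) : ℂ) else 0) +
      if ∅ = S then (Real.sin α : ℂ) else 0 := by
  simp [undecayed, basisKet_block]

lemma decayed_apply (α P : ℝ) (S T : Finset (Fin N)) : decayed α P S (block T 1 0) =
    if S = T then ((Real.cos α * survival P S : ℝ) : ℂ) else 0 := by
  simp [decayed, basisKet_block]

lemma block_univ (a b : Fin 2) : block (univ : Finset (Fin N)) a b = fun _ => a := by
  funext i; simp [block]

lemma block_empty (a b : Fin 2) : block (∅ : Finset (Fin N)) a b = fun _ => b := by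
  funext i; simp [block]

lemma dampedGHZ_diag (hN : 2 ≤ N) (α P : ℝ) (A : Bipartition N) :
    (dampedGHZ N α P (block A.1 1 0) (block A.1 1 0)).re = (Real.cos α * survival P A.1) ^ 2 := by
  simp only [dampedGHZ_eq hN, Matrix.add_apply, Matrix.sum_apply, proj_apply, undecayed_apply,
    decayed_apply, if_neg A.ne_univ, if_neg A.ne_empty]
  rw [Finset.sum_eq_single A]
  · rw [if_pos rfl, Complex.star_def, Complex.conj_ofReal, ← Complex.ofReal_mul]
    simp only [zero_mul, zero_add, add_zero, Complex.ofReal_re, pow_two]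
  · intro B _ hB
    rw [if_neg fun h => hB (Subtype.ext h), zero_mul]
  · simp

lemma dampedGHZ_corner (hN : 2 ≤ N) (α P : ℝ) :
    dampedGHZ N α P (fun _ => 1) (fun _ => 0) =
      ((Real.cos α * survival P (univ : Finset (Fin N)) * Real.sin α : ℝ) : ℂ) := by
  rw [← block_univ 1 0, ← block_empty 1 0]
  have hA : ∀ A : Bipartition N, A.1 ≠ univ := fun A => A.ne_univ.symm
  simp only [dampedGHZ_eq hN, Matrix.add_apply, Matrix.sum_apply, proj_apply, undecayed_apply,
    decayed_apply, if_neg (hA _), if_neg (univ_ne_empty hN), if_neg (univ_ne_empty hN).symm,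
    if_true]
  simp only [zero_mul, add_zero, zero_add, Finset.sum_const_zero, Complex.star_def,
    Complex.conj_ofReal, ← Complex.ofReal_mul]

/-! ### An optimal decomposition -/

lemma trace_proj (φ : Ket N) : (Matrix.trace (proj φ)).re = normSq φ := by
  rw [Matrix.trace, Complex.re_sum, normSq]
  refine Finset.sum_congr rfl fun x _ => ?_
  rw [Matrix.diag_apply, proj_apply, Complex.star_def, Complex.mul_conj, Complex.ofReal_re,
    Complex.normSq_eq_norm_sq]

lemma proj_sqrt_smul {r : ℝ} (hr : 0 ≤ r) (φ : Ket N) :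
    proj ((√r : ℂ) • φ) = (r : ℂ) • proj φ := by
  rw [proj_smul, Complex.star_def, Complex.conj_ofReal, ← Complex.ofReal_mul,
    Real.mul_self_sqrt hr]

/-- Averaging over the opposite phases `1, i, -1, -i` of `a` and `b` removes all coherences between
`u`, `a` and `b`. -/
lemma sum_proj_phases (u a b : Ket N) :
    ∑ k : Fin 4, proj (u + (Complex.I ^ (k : ℕ)) • a + ((-Complex.I) ^ (k : ℕ)) • b) =
      (4 : ℂ) • (proj u + proj a + proj b) := by
  ext x y
  simp only [Matrix.sum_apply, Fin.sum_univ_four, proj_apply, Pi.add_apply, Pi.smul_apply,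
    smul_eq_mul, Matrix.smul_apply, Matrix.add_apply, star_add, star_mul, star_pow, star_neg,
    Complex.star_def, Complex.conj_I]
  have h2 : Complex.I ^ 2 = -1 := Complex.I_sq
  have h3 : Complex.I ^ 3 = -Complex.I := by rw [pow_succ, h2]; ring
  have h4 : Complex.I ^ 4 = 1 := Complex.I_pow_four
  have h6 : Complex.I ^ 6 = -1 := by rw [show 6 = 4 + 2 from rfl, pow_add, h4, h2, one_mul]
  simp only [Fin.val_zero, Fin.val_one, Fin.val_two, show ((3 : Fin 4) : ℕ) = 3 from rfl]
  ring_nf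
  simp only [h2, h3, h4, h6]
  ring

/-- The weights of an optimal decomposition: `β` is the share of the undecayed vector that each
bipartition absorbs, `γ` the share of the decayed vectors that is used up. Either all of the
undecayed vector (first case) or all of the decayed vectors (second case) are used. -/
lemma exists_weights {z w M : ℝ} (hz : 0 ≤ z) (hw : 0 ≤ w) (hM : 0 < M) :
    ∃ β γ : ℝ, 0 ≤ β ∧ M * β ≤ 1 ∧ 0 ≤ γ ∧ γ ≤ 1 ∧ β * z = γ * w ∧
      (1 - M * β) * z = max 0 (z - M * w) := by
  rcases le_or_gt z (M * w) with h | h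
  · refine ⟨1 / M, z / (M * w), by positivity, by field_simp; rfl, by positivity,
      div_le_one_of_le₀ h (by positivity), ?_, ?_⟩
    · rcases hw.eq_or_lt with rfl | hw'
      · have : z = 0 := by linarith
        simp [this]
      · field_simp
    · rw [max_eq_left (by linarith)]
      field_simp
      ring
  · have hz' : 0 < z := lt_of_le_of_lt (by positivity) h
    refine ⟨w / z, 1, by positivity, ?_, zero_le_one, le_rfl, ?_, ?_⟩
    · rw [← mul_div_assoc]
      exact div_le_one_of_le₀ h.le hz
    · field_simp
    · rw [max_eq_right (by linarith)]
      field_simp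

/-- The vector absorbing the shares `β` of the undecayed vector and `γ` of the vectors decayed
to `A` and to `Aᶜ`, with relative phases `iᵏ` and `σ (-i)ᵏ`. -/
noncomputable def absorbing (α P σ β γ : ℝ) (A : Finset (Fin N)) (k : ℕ) : Ket N :=
  (√(β / 8) : ℂ) • undecayed N α P + (Complex.I ^ k) • ((√(γ / 8) : ℂ) • decayed α P A) +
    ((-Complex.I) ^ k) • ((√(γ / 8) : ℂ) • (σ : ℂ) • decayed α P Aᶜ)

lemma sum_proj_absorbing {α P σ β γ : ℝ} (hσ : σ * σ = 1) (hβ : 0 ≤ β) (hγ : 0 ≤ γ)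
    (A : Finset (Fin N)) : ∑ k : Fin 4, proj (absorbing α P σ β γ A k) =
      ((β / 2 : ℝ) : ℂ) • proj (undecayed N α P) + ((γ / 2 : ℝ) : ℂ) • proj (decayed α P A) +
        ((γ / 2 : ℝ) : ℂ) • proj (decayed α P Aᶜ) := by
  simp only [absorbing]
  rw [sum_proj_phases, proj_sqrt_smul (by positivity), proj_sqrt_smul (by positivity),
    proj_sqrt_smul (by positivity), proj_smul (σ : ℂ), Complex.star_def, Complex.conj_ofReal,
    ← Complex.ofReal_mul, hσ]
  push_cast
  module

lemma blockMinor_eq (A : Finset (Fin N)) (φ : Ket N) :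
    blockMinor A φ = φ (block univ 1 0) * φ (block ∅ 1 0) -
      φ (block A 1 0) * φ (block Aᶜ 1 0) := by
  rw [blockMinor, block_compl, block_self, block_self, block_univ, block_empty]

lemma decayed_support (α P : ℝ) {S : Finset (Fin N)} {x : Config N} (h : decayed α P S x ≠ 0) :
    x = block S 1 0 := by
  by_contra hx
  exact h (by simp [decayed, basisKet, Pi.single_eq_of_ne hx])

lemma undecayed_support (α P : ℝ) (A : Finset (Fin N)) {x : Config N}
    (h : undecayed N α P x ≠ 0) : ∃ a b, x = block A a b := by
  by_contra! hx
  have h1 : x ≠ block univ 1 0 := by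
    rw [block_univ, ← block_self A]
    exact hx 1 1
  have h2 : x ≠ block ∅ 1 0 := by
    rw [block_empty, ← block_self A]
    exact hx 0 0
  exact h (by simp [undecayed, basisKet, Pi.single_eq_of_ne h1, Pi.single_eq_of_ne h2])

lemma minorSum_decayed_empty (hN : 2 ≤ N) (α P : ℝ) (A : Bipartition N) :
    minorSum A.1 (decayed α P ∅) = 0 := by
  rw [minorSum_of_support A _ fun x hx =>
    ⟨0, 0, by rw [decayed_support α P hx, block_empty, block_self]⟩, blockMinor_eq]
  simp only [decayed_apply, if_neg A.ne_empty, if_neg (univ_ne_empty hN).symm]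
  simp

lemma minorSum_decayed (α P : ℝ) (A : Bipartition N) : minorSum A.1 (decayed α P A.1) = 0 := by
  rw [minorSum_of_support A _ fun x hx => ⟨1, 0, decayed_support α P hx⟩, blockMinor_eq]
  simp only [decayed_apply, if_neg A.ne_compl, if_neg A.ne_univ.symm]
  simp

lemma minorSum_undecayed (hN : 2 ≤ N) (α P : ℝ) (A : Bipartition N) :
    minorSum A.1 (undecayed N α P) =
      (2 * |Real.cos α * survival P (univ : Finset (Fin N)) * Real.sin α|) ^ 2 := by
  rw [minorSum_of_support A _ fun x hx => undecayed_support α P A.1 hx, blockMinor_eq]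
  simp only [undecayed_apply, if_neg A.ne_univ, if_neg A.ne_empty, if_neg (univ_ne_empty hN),
    if_neg (univ_ne_empty hN).symm, if_true, add_zero, zero_add, zero_mul, sub_zero,
    ← Complex.ofReal_mul, Complex.norm_real, Real.norm_eq_abs]

/-- The two products in the block minor of an absorbing vector cancel, so that this vector has no
entanglement between `A` and `Aᶜ`. -/
lemma minorSum_absorbing (hN : 2 ≤ N) {α P σ β γ : ℝ} (hβ : 0 ≤ β) (hγ : 0 ≤ γ)
    (h : β * (Real.cos α * survival P (univ : Finset (Fin N)) * Real.sin α) =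
      γ * (σ * (Real.cos α ^ 2 * (√(1 - P) * √P) ^ N))) (A : Bipartition N) (k : ℕ) :
    minorSum A.1 (absorbing α P σ β γ A.1 k) = 0 := by
  rw [minorSum_of_support A, blockMinor_eq]
  · have hI : Complex.I ^ k * (-Complex.I) ^ k = 1 := by
      rw [← mul_pow, mul_neg, Complex.I_mul_I, neg_neg, one_pow]
    have hb : ((√(β / 8) : ℝ) : ℂ) * (√(β / 8) : ℝ) = β / 8 := by
      rw [← Complex.ofReal_mul, Real.mul_self_sqrt (by positivity)]
      push_cast
      rfl
    have hg : ((√(γ / 8) : ℝ) : ℂ) * (√(γ / 8) : ℝ) = γ / 8 := by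
      rw [← Complex.ofReal_mul, Real.mul_self_sqrt (by positivity)]
      push_cast
      rfl
    have hA : univ ≠ A.1ᶜ := A.compl.ne_univ
    have hA' : ∅ ≠ A.1ᶜ := A.compl.ne_empty
    rw [← survival_mul_survival_compl P A.1] at h
    have h' := congrArg (fun r : ℝ => (r : ℂ)) h
    push_cast at h'
    simp only [absorbing, Pi.add_apply, Pi.smul_apply, smul_eq_mul, undecayed_apply,
      decayed_apply, if_neg A.ne_univ, if_neg A.ne_empty, if_neg (univ_ne_empty hN),
      if_neg (univ_ne_empty hN).symm, if_true, if_neg A.ne_univ.symm, if_neg A.ne_empty.symm,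
      if_neg hA, if_neg hA', if_neg hA.symm, if_neg hA'.symm, if_neg A.ne_compl,
      if_neg A.ne_compl.symm, add_zero, zero_add, mul_zero]
    push_cast
    -- Collect the square roots, the opposite phases and the two survival amplitudes.
    rw [show ∀ b v s g p q a a' d : ℂ, b * v * (b * s) - p * (g * a) * (q * (g * (d * a'))) =
      (b * b) * (v * s) - (p * q) * (g * g) * (d * (a * a')) by intros; ring, hI, hb, hg]
    rw [show ∀ z : ℂ, z = 0 → (2 * ‖z‖) ^ 2 = 0 by rintro z rfl; simp]
    linear_combination h' / 8
  · intro x hx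
    by_contra! hx'
    have h1 : undecayed N α P x = 0 := by
      by_contra h1
      obtain ⟨a, b, hab⟩ := undecayed_support α P A.1 h1
      exact hx' a b hab
    have h2 : decayed α P A.1 x = 0 := by
      by_contra h2
      exact hx' 1 0 (decayed_support α P h2)
    have h3 : decayed α P A.1ᶜ x = 0 := by
      by_contra h3
      exact hx' 0 1 (by rw [decayed_support α P h3, block_compl])
    exact hx (by simp [absorbing, h1, h2, h3])

/-- The decomposition consists of the rest of the undecayed vector, the vector in which all qubits
have decayed, the rests of the other decayed vectors, and the absorbing vectors. Only the first of
them contributes to the average concurrence. -/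
lemma exists_optimal_decomposition (hN : 2 ≤ N) (α : ℝ) {P : ℝ} (hP0 : 0 ≤ P) (hP1 : P ≤ 1) :
    ∃ c ∈ averageConcurrences (dampedGHZ N α P),
      c ≤ 2 * max 0 (|Real.cos α * survival P (univ : Finset (Fin N)) * Real.sin α| -
        ((2 : ℝ) ^ (N - 1) - 1) * (Real.cos α ^ 2 * (√(1 - P) * √P) ^ N)) := by
  set z₀ := Real.cos α * survival P (univ : Finset (Fin N)) * Real.sin α with hz₀
  set M : ℝ := (2 : ℝ) ^ (N - 1) - 1 with hM
  have hMpos : 0 < M := sub_pos.2 (one_lt_pow₀ one_lt_two (by omega))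
  obtain ⟨β, γ, hβ, hβ1, hγ, hγ1, hβγ, hmax⟩ := exists_weights (abs_nonneg z₀)
    (by positivity : 0 ≤ Real.cos α ^ 2 * (√(1 - P) * √P) ^ N) hMpos
  -- The sign of `z₀` is given to the absorbing vectors, so that their minors cancel.
  obtain ⟨σ, hσ, hσz⟩ : ∃ σ : ℝ, σ * σ = 1 ∧ z₀ = σ * |z₀| := by
    rcases abs_cases z₀ with ⟨h, -⟩ | ⟨h, -⟩
    · exact ⟨1, by norm_num, by rw [h, one_mul]⟩
    · exact ⟨-1, by norm_num, by rw [h]; ring⟩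
  have hcancel : β * z₀ = γ * (σ * (Real.cos α ^ 2 * (√(1 - P) * √P) ^ N)) := by
    rw [hσz]
    linear_combination σ * hβγ
  obtain ⟨A₀⟩ := exists_bipartition hN
  -- The weights `1 / 8` in `absorbing` account for four phases and for each bipartition occurring
  -- twice, as `A` and as `Aᶜ`.
  let φ : Unit ⊕ Unit ⊕ Bipartition N ⊕ (Bipartition N × Fin 4) → Ket N :=
    Sum.elim (fun _ => (√(1 - M * β) : ℂ) • undecayed N α P) <|
    Sum.elim (fun _ => decayed α P ∅) <|
    Sum.elim (fun A => (√(1 - γ) : ℂ) • decayed α P A.1)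
      (fun q => absorbing α P σ β γ q.1.1 q.2)
  let A : Unit ⊕ Unit ⊕ Bipartition N ⊕ (Bipartition N × Fin 4) → Bipartition N :=
    Sum.elim (fun _ => A₀) <| Sum.elim (fun _ => A₀) <| Sum.elim id Prod.fst
  have hρ : ∑ i, proj (φ i) = dampedGHZ N α P := by
    have hcompl : ∑ A : Bipartition N, proj (decayed α P A.1ᶜ) =
        ∑ A : Bipartition N, proj (decayed α P A.1) :=
      complEquiv.sum_comp fun A : Bipartition N => proj (decayed α P A.1)
    have hcard : (Fintype.card (Bipartition N) : ℂ) = 2 * M := by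
      have h : (Fintype.card (Bipartition N) : ℝ) = 2 * M := card_bipartition hN
      have h' := congrArg (fun r : ℝ => (r : ℂ)) h
      push_cast at h'
      exact h'
    simp only [φ, Fintype.sum_sum_type, Sum.elim_inl, Sum.elim_inr, Fintype.sum_prod_type,
      univ_unique, sum_singleton, sum_proj_absorbing hσ hβ hγ,
      proj_sqrt_smul (sub_nonneg.2 hβ1), proj_sqrt_smul (sub_nonneg.2 hγ1),
      Finset.sum_add_distrib, ← Finset.smul_sum, hcompl]
    rw [dampedGHZ_eq hN, sum_const, card_univ, ← Nat.cast_smul_eq_nsmul ℂ, hcard]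
    push_cast
    module
  have htr : ∑ i, normSq (φ i) = 1 := by
    simp only [← trace_proj]
    rw [← Complex.re_sum, ← Matrix.trace_sum, hρ, dampedGHZ_eq hN, Matrix.trace_add,
      Matrix.trace_add, Matrix.trace_sum, Complex.add_re, Complex.add_re, Complex.re_sum]
    simp only [trace_proj]
    exact normSq_undecayed_add hN α hP0 hP1
  obtain ⟨c, hc, hcle⟩ := exists_averageConcurrence_le φ A htr
  rw [hρ] at hc
  refine ⟨c, hc, hcle.trans (le_of_eq ?_)⟩
  simp only [φ, A, Fintype.sum_sum_type, Sum.elim_inl, Sum.elim_inr, univ_unique, sum_singleton,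
    id, minorSum_smul, minorSum_undecayed hN, minorSum_decayed_empty hN, minorSum_decayed,
    minorSum_absorbing hN hβ hγ hcancel, mul_zero, Real.sqrt_zero, sum_const_zero, add_zero,
    ← hz₀]
  rw [Real.sq_sqrt (sub_nonneg.2 hβ1), ← mul_pow,
    Real.sqrt_sq (mul_nonneg (sub_nonneg.2 hβ1) (by positivity)), ← hmax]
  ring

theorem gmConcurrence_dampedGHZ (hN : 2 ≤ N) (α : ℝ) {P : ℝ} (hP0 : 0 ≤ P) (hP1 : P ≤ 1) :
    gmConcurrence (dampedGHZ N α P) ∈ averageConcurrences (dampedGHZ N α P) ∧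
      gmConcurrence (dampedGHZ N α P) =
        2 * max 0 (|Real.cos α * survival P (univ : Finset (Fin N)) * Real.sin α| -
          ((2 : ℝ) ^ (N - 1) - 1) * (Real.cos α ^ 2 * (√(1 - P) * √P) ^ N)) := by
  obtain ⟨c, hc, hcle⟩ := exists_optimal_decomposition hN α hP0 hP1
  refine gmConcurrence_eq_of_le (fun c hc => ?_) hc hcle
  rw [mul_max_of_nonneg _ _ zero_le_two, mul_zero]
  refine max_le (averageConcurrence_nonneg hc) (le_trans (le_of_eq ?_)
    (averageConcurrence_ge hN hc))
  have hA : ∀ A : Bipartition N,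
      √(dampedGHZ N α P (block A.1 1 0) (block A.1 1 0)).re *
        √(dampedGHZ N α P (block A.1 0 1) (block A.1 0 1)).re =
      Real.cos α ^ 2 * (√(1 - P) * √P) ^ N := by
    intro A
    have h := dampedGHZ_diag hN α P A.compl
    rw [show A.compl.1 = A.1ᶜ from rfl, block_compl] at h
    rw [h, dampedGHZ_diag hN, Real.sqrt_sq_eq_abs, Real.sqrt_sq_eq_abs, abs_mul, abs_mul,
      abs_of_nonneg (survival_nonneg P A.1), abs_of_nonneg (survival_nonneg P A.1ᶜ),
      ← survival_mul_survival_compl P A.1, ← sq_abs (Real.cos α)]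
    ring
  simp only [hA, dampedGHZ_corner hN, sum_const, card_univ, nsmul_eq_mul, card_bipartition hN,
    Complex.norm_real, Real.norm_eq_abs]
  ring

/-! ### The closed formula and the critical decay probability -/

lemma rpow_half_eq {x : ℝ} (hx : 0 ≤ x) (N : ℕ) : x ^ ((N : ℝ) / 2) = √x ^ N := by
  rw [Real.rpow_div_two_eq_sqrt _ hx, Real.rpow_natCast]

lemma cos_sq_mul_abs_tan (α : ℝ) : Real.cos α ^ 2 * |Real.tan α| = |Real.cos α * Real.sin α| := by
  by_cases h : Real.cos α = 0
  · simp [h]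
  · rw [Real.tan_eq_sin_div_cos, abs_div, abs_mul, ← sq_abs]
    have := abs_pos.2 h
    field_simp

/-- The value of the concurrence in the variables of the closed formula; where `cos α = 0`, both
sides vanish. -/
lemma two_mul_max_eq (α : ℝ) {P : ℝ} (hP0 : 0 ≤ P) (hP1 : P ≤ 1) (M : ℝ) :
    2 * max 0 (|Real.cos α * survival P (univ : Finset (Fin N)) * Real.sin α| -
        M * (Real.cos α ^ 2 * (√(1 - P) * √P) ^ N)) =
      max 0 (2 * Real.cos α ^ 2 * (1 - P) ^ ((N : ℝ) / 2) *
        (|Real.tan α| - M * P ^ ((N : ℝ) / 2))) := by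
  rw [mul_max_of_nonneg _ _ zero_le_two, mul_zero, rpow_half_eq hP0, rpow_half_eq (by linarith),
    survival_univ, mul_right_comm, abs_mul, ← cos_sq_mul_abs_tan,
    abs_of_nonneg (by positivity : 0 ≤ √(1 - P) ^ N), mul_pow]
  congr 1
  ring

lemma criticalP_le_iff (hN : 2 ≤ N) (α : ℝ) {P : ℝ} (hP0 : 0 ≤ P) :
    criticalP N α ≤ P ↔ |Real.tan α| ≤ ((2 : ℝ) ^ (N - 1) - 1) * P ^ ((N : ℝ) / 2) := by
  have hM : (0 : ℝ) < 2 ^ (N - 1) - 1 := sub_pos.2 (one_lt_pow₀ one_lt_two (by omega))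
  have hN' : (0 : ℝ) < N := by exact_mod_cast (by omega : 0 < N)
  rw [criticalP, ← inv_div (N : ℝ) 2, Real.rpow_inv_le_iff_of_pos (by positivity) hP0
    (by positivity), div_le_iff₀' hM]

lemma formula_eq_zero_iff (hN : 2 ≤ N) {α : ℝ} (hα : Real.cos α ≠ 0) {P : ℝ} (hP0 : 0 ≤ P)
    (hP1 : P ≤ 1) :
    max 0 (2 * Real.cos α ^ 2 * (1 - P) ^ ((N : ℝ) / 2) *
      (|Real.tan α| - ((2 : ℝ) ^ (N - 1) - 1) * P ^ ((N : ℝ) / 2))) = 0 ↔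
    P = 1 ∨ criticalP N α ≤ P := by
  rw [max_eq_left_iff, criticalP_le_iff hN α hP0]
  rcases hP1.eq_or_lt with rfl | h
  · rw [sub_self, Real.zero_rpow (by positivity)]
    simp
  · have : 0 < 2 * Real.cos α ^ 2 * (1 - P) ^ ((N : ℝ) / 2) :=
      mul_pos (by positivity) (Real.rpow_pos_of_pos (by linarith) _)
    rw [← not_lt, mul_pos_iff_of_pos_left this, not_lt, sub_nonpos]
    simp [h.ne]

end GMConcurrence

theorem mainTheorem2 (N : ℕ) (hN : 2 ≤ N) (α : ℝ) :
    (∀ P ∈ Set.Icc (0 : ℝ) 1,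
      GMConcurrence.gmConcurrence (GMConcurrence.dampedGHZ N α P) ∈
          GMConcurrence.averageConcurrences (GMConcurrence.dampedGHZ N α P) ∧
        GMConcurrence.gmConcurrence (GMConcurrence.dampedGHZ N α P) =
          max 0 (2 * Real.cos α ^ 2 * (1 - P) ^ ((N : ℝ) / 2) *
            (|Real.tan α| - ((2 : ℝ) ^ (N - 1) - 1) * P ^ ((N : ℝ) / 2)))) ∧
    (Real.cos α ≠ 0 →
      (GMConcurrence.criticalP N α < 1 → ∀ P ∈ Set.Icc (0 : ℝ) 1,
        (GMConcurrence.gmConcurrence (GMConcurrence.dampedGHZ N α P) = 0 ↔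
          GMConcurrence.criticalP N α ≤ P)) ∧
      (1 ≤ GMConcurrence.criticalP N α → ∀ P ∈ Set.Icc (0 : ℝ) 1,
        (GMConcurrence.gmConcurrence (GMConcurrence.dampedGHZ N α P) = 0 ↔ P = 1))) := by
  have key : ∀ P ∈ Set.Icc (0 : ℝ) 1,
      GMConcurrence.gmConcurrence (GMConcurrence.dampedGHZ N α P) ∈
          GMConcurrence.averageConcurrences (GMConcurrence.dampedGHZ N α P) ∧
        GMConcurrence.gmConcurrence (GMConcurrence.dampedGHZ N α P) =
          max 0 (2 * Real.cos α ^ 2 * (1 - P) ^ ((N : ℝ) / 2) *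
            (|Real.tan α| - ((2 : ℝ) ^ (N - 1) - 1) * P ^ ((N : ℝ) / 2))) := by
    rintro P ⟨hP0, hP1⟩
    rw [← GMConcurrence.two_mul_max_eq α hP0 hP1]
    exact GMConcurrence.gmConcurrence_dampedGHZ hN α hP0 hP1
  refine ⟨key, fun hα => ⟨fun hc P hP => ?_, fun hc P hP => ?_⟩⟩
  · rw [(key P hP).2, GMConcurrence.formula_eq_zero_iff hN hα hP.1 hP.2]
    exact ⟨fun h => h.elim (fun h => h ▸ hc.le) id, Or.inr⟩
  · rw [(key P hP).2, GMConcurrence.formula_eq_zero_iff hN hα hP.1 hP.2]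
    exact ⟨fun h => h.elim id fun h => le_antisymm hP.2 (hc.trans h), Or.inl⟩
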